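/- Let $\alpha,\beta\ge 0$ and let $F=F^{(\alpha,\beta)}_{dK}:(0,\infty)^2\to(0,\infty)^2$ be the (modified) discrete KdV map \[F(x,u)=\left(\frac{u(1+\beta xu)}{1+\alpha xu},\ \frac{x(1+\alpha xu)}{1+\beta xu}\right).\] A pair $(\mu,\nu)$ of probability measures on $(0,\infty)$ is said to satisfy the detailed balance condition if $F(\mu\times\nu)=\mu\times\nu$, where $F(\mu\times\nu)=(\mu\times\nu)\circ F^{-1}$ is the image measure. For $\lambda\in\mathbb{R}$, $c_1\ge 0$, $c_2>0$ (with $\lambda>0$ if $c_1=0$) let $\mathrm{GIG}(\lambda,c_1,c_2)$ be the probability measure on $(0,\infty)$ with density $Z^{-1}x^{-\lambda-1}e^{-c_1x-c_2x^{-1}}$, where $Z$ is a normalizing constant; for $c_1=0$ this is the inverse gamma distribution $\mathrm{IG}(\lambda,c_2)$. (a) For every $c>0$ and every $\lambda\in\mathbb{R}$, with $\lambda>0$ if $\alpha\beta=0$, the pair $\mu=\mathrm{GIG}(\lambda,c\alpha,c)$, $\nu=\mathrm{GIG}(\lambda,c\beta,c)$ satisfies the detailed balance condition. (b) If $\alpha=\beta$,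 then for every probability measure $m$ on $(0,\infty)$ the pair $\mu=\nu=m$ satisfies the detailed balance condition. (c) If $\alpha\beta=0$, there are no other non-trivial solutions: if $(\mu,\nu)$ satisfies the detailed balance condition and $\mu\times\nu$ is not a Dirac measure, then either there are $\lambda>0$ and $c>0$ with $\mu=\mathrm{GIG}(\lambda,c\alpha,c)$ and $\nu=\mathrm{GIG}(\lambda,c\beta,c)$, or $\alpha=\beta$ (so $\alpha=\beta=0$) and $\mu=\nu$. -/

import Mathlib

open MeasureTheory
open scoped NNReal ENNReal

noncomputable section

/-- The half-line `(0, ∞)`, in which the variables `x` and `u` of the discrete KdV system live. -/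
abbrev PosReal : Type := Set.Ioi (0 : ℝ)

/-- The discrete KdV map
`F(x, u) = (u (1 + β x u) / (1 + α x u), x (1 + α x u) / (1 + β x u))` on `(0, ∞)²`. -/
def dKdVMap (α β : ℝ≥0) (p : PosReal × PosReal) : PosReal × PosReal :=
  have hx : 0 < p.1.1 := p.1.2
  have hu : 0 < p.2.1 := p.2.2
  (⟨p.2.1 * (1 + β * p.1.1 * p.2.1) / (1 + α * p.1.1 * p.2.1), Set.mem_Ioi.2 (by positivity)⟩,
   ⟨p.1.1 * (1 + α * p.1.1 * p.2.1) / (1 + β * p.1.1 * p.2.1), Set.mem_Ioi.2 (by positivity)⟩)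

/-- `μ` and `ν` are probability measures, and the image of `μ × ν` under `F` is `μ × ν`. -/
structure DetailedBalance {X U : Type*} [MeasurableSpace X] [MeasurableSpace U]
    (F : X × U → X × U) (μ : Measure X) (ν : Measure U) : Prop where
  isProbabilityMeasure_left : IsProbabilityMeasure μ
  isProbabilityMeasure_right : IsProbabilityMeasure ν
  map_eq : (μ.prod ν).map F = μ.prod ν

/-- The unnormalized density `x ^ (-l - 1) * exp (-c₁ x - c₂ / x)`, `x > 0`. -/
def gigWeight (l c₁ c₂ : ℝ) (x : PosReal) : ℝ≥0∞ :=
  ENNReal.ofReal ((x : ℝ) ^ (-l - 1) * Real.exp (-c₁ * x - c₂ * (x : ℝ)⁻¹))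

/-- Lebesgue measure on `(0, ∞)`. -/
def lebesguePos : Measure PosReal := Measure.comap Subtype.val (volume : Measure ℝ)

/-- The generalized inverse Gaussian distribution `GIG(l, c₁, c₂)`, which has density
`Z⁻¹ x ^ (-l - 1) exp (-c₁ x - c₂ / x)` on `(0, ∞)`, with `Z` the normalizing constant.
For `c₁ = 0` (and `l, c₂ > 0`) the density is that of the inverse gamma distribution `IG(l, c₂)`,
in accordance with the convention `GIG(l, 0, c₂) = IG(l, c₂)`. -/
def gig (l c₁ c₂ : ℝ) : Measure PosReal :=
  (∫⁻ x, gigWeight l c₁ c₂ x ∂lebesguePos)⁻¹ • lebesguePos.withDensity (gigWeight l c₁ c₂)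

end

/-! Write (y, v) = F(x, u). The map conserves xu and αx + 1/x + βu + 1/u. In the coordinates (log x,
log u) it also preserves Lebesgue measure, being a composition of shears, reflections and swaps. The
product GIG density is a function of the two conserved quantities, which gives (a)
(`measurePreserving_dKdVLog`, `gigLogWeight_dKdVLog`). For α = β the map is the coordinate swap,
which gives (b) and forces μ = ν in (c).

For (c), conjugation by the swap leaves the case α = 0 < β, where 1/v = 1/x + βu and 1/y + βv = 1/u.
Put f(t) = E[exp(t/X)] for t < 0. Testing invariance against exp(s(1/x + βu) + t/u) times monomials
in 1/x and 1/u gives identities between moments of μ and of ν. Eliminating ν leaves a constant ratio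
κ = f f''/f'² (`DetailedBalance.invMoment_ratio_eq`). If κ ≤ 1, equality in Cauchy–Schwarz makes μ a
Dirac measure, and then ν is one too. If κ > 1, integrating the equation gives f(t) = (c/(c - t))^l,
the transform of the inverse gamma law.

Once μ is known, ν is invariant under the Markov kernel sending u to the law of v, where 1/v = 1/X +
βu. Any two of its transition laws charge a common ray, so the invariant law is unique
(`eq_of_invariant_of_not_mutuallySingular`), and (a) supplies it. -/

open ProbabilityTheory

/-! ### Generalized inverse Gaussian laws in the coordinate log x -/

/-- The exponential map from the line onto the half-line. -/
noncomputable def expPos (ξ : ℝ) : PosReal := ⟨Real.exp ξ, Set.mem_Ioi.2 (Real.exp_pos ξ)⟩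

/-- The weight of the generalized inverse Gaussian distribution in the coordinate `log x`. -/
noncomputable def gigLogWeight (l c₁ c₂ ξ : ℝ) : ℝ≥0∞ :=
  ENNReal.ofReal (Real.exp (-l * ξ - c₁ * Real.exp ξ - c₂ * Real.exp (-ξ)))

lemma measurable_expPos : Measurable expPos :=
  Measurable.subtype_mk Real.measurable_exp

lemma measurable_gigLogWeight (l c₁ c₂ : ℝ) : Measurable (gigLogWeight l c₁ c₂) := by
  unfold gigLogWeight; fun_prop

lemma measurable_gigWeight (l c₁ c₂ : ℝ) : Measurable (gigWeight l c₁ c₂) := by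
  unfold gigWeight; fun_prop

lemma lintegral_lebesguePos (f : PosReal → ℝ≥0∞) :
    ∫⁻ x, f x ∂lebesguePos = ∫⁻ ξ, ENNReal.ofReal (Real.exp ξ) * f (expPos ξ) := by
  have hm : MeasurableEmbedding (Subtype.val : PosReal → ℝ) :=
    MeasurableEmbedding.subtype_coe measurableSet_Ioi
  set g : ℝ → ℝ≥0∞ := Function.extend Subtype.val f 0 with hg
  have hgf (x : PosReal) : g x = f x := Subtype.val_injective.extend_apply f 0 x
  have h1 : ∫⁻ x, f x ∂lebesguePos = ∫⁻ x in Set.Ioi (0 : ℝ), g x := by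
    have hr : volume.restrict (Set.Ioi (0 : ℝ)) = lebesguePos.map Subtype.val := by
      rw [lebesguePos, hm.map_comap, Subtype.range_coe]
    rw [hr, hm.lintegral_map]
    simp_rw [hgf]
  have h2 := lintegral_image_eq_lintegral_abs_deriv_mul (s := Set.univ) (f := Real.exp)
    (f' := Real.exp) MeasurableSet.univ
    (fun x _ => (Real.hasDerivAt_exp x).hasDerivWithinAt) Real.exp_injective.injOn g
  rw [h1, ← Real.range_exp, ← Set.image_univ, h2, Measure.restrict_univ]
  refine lintegral_congr fun ξ => ?_
  rw [abs_of_pos (Real.exp_pos ξ)]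
  congr 1
  exact hgf (expPos ξ)

/-- The Jacobian of x = exp ξ absorbs the -1 in the exponent -l - 1. -/
lemma ofReal_exp_mul_gigWeight (l c₁ c₂ ξ : ℝ) :
    ENNReal.ofReal (Real.exp ξ) * gigWeight l c₁ c₂ (expPos ξ) = gigLogWeight l c₁ c₂ ξ := by
  have : ((expPos ξ : PosReal) : ℝ) = Real.exp ξ := rfl
  rw [gigWeight, gigLogWeight, ← ENNReal.ofReal_mul (Real.exp_pos ξ).le, this, ← Real.exp_mul,
    ← Real.exp_add, ← Real.exp_add, Real.exp_neg ξ]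
  congr 2; ring

/-- The generalized inverse Gaussian distribution in the coordinate `log x`. -/
noncomputable def gigLog (l c₁ c₂ : ℝ) : Measure ℝ :=
  volume.withDensity fun ξ => (∫⁻ ξ, gigLogWeight l c₁ c₂ ξ)⁻¹ * gigLogWeight l c₁ c₂ ξ

lemma gig_eq_map (l c₁ c₂ : ℝ) : gig l c₁ c₂ = (gigLog l c₁ c₂).map expPos := by
  have hw := measurable_gigWeight l c₁ c₂
  have hlw := measurable_gigLogWeight l c₁ c₂
  ext s hs
  rw [gig, lintegral_lebesguePos, Measure.map_apply measurable_expPos hs, gigLog,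
    Measure.smul_apply, withDensity_apply _ hs, withDensity_apply _ (measurable_expPos hs),
    lintegral_const_mul _ hlw, smul_eq_mul, ← lintegral_indicator hs,
    lintegral_lebesguePos, ← lintegral_indicator (measurable_expPos hs)]
  simp_rw [ofReal_exp_mul_gigWeight]
  congr 1
  refine lintegral_congr fun ξ => ?_
  by_cases h : expPos ξ ∈ s
  · rw [Set.indicator_of_mem h, Set.indicator_of_mem (Set.mem_preimage.2 h),
      ofReal_exp_mul_gigWeight]
  · rw [Set.indicator_of_notMem h, mul_zero, Set.indicator_of_notMem (show ξ ∉ expPos ⁻¹' s from h)]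

lemma lintegral_gigLogWeight_neg (l c₁ c₂ : ℝ) :
    ∫⁻ ξ, gigLogWeight (-l) c₂ c₁ ξ = ∫⁻ ξ, gigLogWeight l c₁ c₂ ξ := by
  rw [← (Measure.measurePreserving_neg (volume : Measure ℝ)).lintegral_comp
    (measurable_gigLogWeight l c₁ c₂)]
  refine lintegral_congr fun ξ => ?_
  simp only [gigLogWeight, neg_neg]
  congr 2; ring

lemma lintegral_gigLogWeight_zero_right {l r : ℝ} (hl : 0 < l) (hr : 0 < r) :
    ∫⁻ ξ, gigLogWeight l 0 r ξ = ENNReal.ofReal ((1 / r) ^ l * Real.Gamma l) := by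
  -- The Bochner integral of a non-integrable function is 0, whereas the Gamma integral is positive.
  have hI : IntegrableOn (fun t : ℝ => t ^ (l - 1) * Real.exp (-(r * t))) (Set.Ioi 0) := by
    have h := Real.integral_rpow_mul_exp_neg_mul_Ioi hl hr
    by_contra hn
    rw [integral_undef hn] at h
    have := Real.Gamma_pos_of_pos hl
    have : 0 < (1 / r) ^ l * Real.Gamma l := by positivity
    linarith
  rw [← lintegral_gigLogWeight_neg, ← Real.integral_rpow_mul_exp_neg_mul_Ioi hl hr,
    ofReal_integral_eq_lintegral_ofReal hI]
  · have h2 := lintegral_image_eq_lintegral_abs_deriv_mul (s := Set.univ) (f := Real.exp)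
      (f' := Real.exp) MeasurableSet.univ
      (fun x _ => (Real.hasDerivAt_exp x).hasDerivWithinAt) Real.exp_injective.injOn
      (fun t : ℝ => ENNReal.ofReal (t ^ (l - 1) * Real.exp (-(r * t))))
    rw [← Real.range_exp, ← Set.image_univ, h2, Measure.restrict_univ]
    refine lintegral_congr fun ξ => ?_
    rw [abs_of_pos (Real.exp_pos ξ), ← ENNReal.ofReal_mul (Real.exp_pos ξ).le, gigLogWeight,
      ← Real.exp_mul, ← Real.exp_add, ← Real.exp_add]
    congr 2; ring
  · filter_upwards [ae_restrict_mem measurableSet_Ioi] with t ht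
    have : (0 : ℝ) < t := ht
    positivity

lemma lintegral_gigLogWeight_ne_zero (l c₁ c₂ : ℝ) : ∫⁻ ξ, gigLogWeight l c₁ c₂ ξ ≠ 0 := by
  rw [ne_eq, lintegral_eq_zero_iff (measurable_gigLogWeight l c₁ c₂)]
  intro h
  obtain ⟨ξ, hξ⟩ := h.exists
  exact (ENNReal.ofReal_pos.2 (Real.exp_pos _)).ne' hξ

lemma lintegral_gigLogWeight_ne_top {l c₁ c₂ : ℝ} (h₁ : 0 ≤ c₁) (h₂ : 0 < c₂)
    (hl : c₁ = 0 → 0 < l) : ∫⁻ ξ, gigLogWeight l c₁ c₂ ξ ≠ ⊤ := by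
  rcases h₁.eq_or_lt with rfl | h₁
  · rw [lintegral_gigLogWeight_zero_right (hl rfl) h₂]
    exact ENNReal.ofReal_ne_top
  have hk : 0 < |l| + 1 := by positivity
  -- The first weight dominates on ξ ≤ 0, the second on ξ ≥ 0; both have Gamma integrals.
  have hle : ∀ ξ, gigLogWeight l c₁ c₂ ξ ≤
      gigLogWeight (|l| + 1) 0 c₂ ξ + gigLogWeight (-(|l| + 1)) c₁ 0 ξ := by
    intro ξ
    have e1 := Real.exp_pos ξ
    have e2 := Real.exp_pos (-ξ)
    rcases le_total 0 ξ with h | h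
    · refine le_trans (ENNReal.ofReal_le_ofReal (Real.exp_le_exp.2 ?_)) le_add_self
      nlinarith [neg_abs_le l, mul_pos h₂ e2]
    · refine le_trans (ENNReal.ofReal_le_ofReal (Real.exp_le_exp.2 ?_)) le_self_add
      nlinarith [le_abs_self l, mul_pos h₁ e1]
  refine ne_top_of_le_ne_top ?_ (lintegral_mono hle)
  rw [lintegral_add_left (measurable_gigLogWeight _ _ _), lintegral_gigLogWeight_neg,
    lintegral_gigLogWeight_zero_right hk h₂, lintegral_gigLogWeight_zero_right hk h₁]
  exact ENNReal.add_ne_top.2 ⟨ENNReal.ofReal_ne_top, ENNReal.ofReal_ne_top⟩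

lemma isProbabilityMeasure_gigLog {l c₁ c₂ : ℝ} (h₁ : 0 ≤ c₁) (h₂ : 0 < c₂)
    (hl : c₁ = 0 → 0 < l) : IsProbabilityMeasure (gigLog l c₁ c₂) := by
  refine ⟨?_⟩
  rw [gigLog, withDensity_apply _ MeasurableSet.univ, Measure.restrict_univ,
    lintegral_const_mul _ (measurable_gigLogWeight _ _ _)]
  exact ENNReal.inv_mul_cancel (lintegral_gigLogWeight_ne_zero _ _ _)
    (lintegral_gigLogWeight_ne_top h₁ h₂ hl)

lemma isProbabilityMeasure_gig {l c₁ c₂ : ℝ} (h₁ : 0 ≤ c₁) (h₂ : 0 < c₂)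
    (hl : c₁ = 0 → 0 < l) : IsProbabilityMeasure (gig l c₁ c₂) := by
  have := isProbabilityMeasure_gigLog h₁ h₂ hl
  rw [gig_eq_map]
  exact Measure.isProbabilityMeasure_map measurable_expPos.aemeasurable

/-! ### Detailed balance for GIG laws -/

/-- The discrete KdV map in logarithmic coordinates. -/
noncomputable def dKdVLog (α β : ℝ≥0) (z : ℝ × ℝ) : ℝ × ℝ :=
  (z.2 + Real.log ((1 + β * Real.exp (z.1 + z.2)) / (1 + α * Real.exp (z.1 + z.2))),
   z.1 - Real.log ((1 + β * Real.exp (z.1 + z.2)) / (1 + α * Real.exp (z.1 + z.2))))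

/-- The sum p = log x + log u is conserved. In the coordinates (p, log x) the map is, for each fixed
p, a reflection of the line, and the changes of coordinates are shears and swaps. -/
lemma measurePreserving_dKdVLog (α β : ℝ≥0) :
    MeasurePreserving (dKdVLog α β) (volume.prod volume) (volume.prod volume) := by
  have hswap := Measure.measurePreserving_swap (μ := (volume : Measure ℝ)) (ν := (volume : Measure ℝ))
  have h1 := hswap.comp (measurePreserving_prod_add (volume : Measure ℝ) (volume : Measure ℝ))
  have h2 : MeasurePreserving (fun z : ℝ × ℝ => (z.1,
      (z.1 + Real.log ((1 + β * Real.exp z.1) / (1 + α * Real.exp z.1))) - z.2))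
      (volume.prod volume) (volume.prod volume) := by
    refine (MeasurePreserving.id (volume : Measure ℝ)).skew_product (g := fun p ξ =>
      (p + Real.log ((1 + β * Real.exp p) / (1 + α * Real.exp p))) - ξ) ?_ ?_
    · fun_prop
    · exact Filter.Eventually.of_forall fun p => (Measure.measurePreserving_sub_left _ _).map_eq
  have h3 : MeasurePreserving (fun z : ℝ × ℝ => (z.1, z.2 - z.1))
      (volume.prod volume) (volume.prod volume) := by
    refine (MeasurePreserving.id (volume : Measure ℝ)).skew_product (g := fun x p => p - x) ?_ ?_
    · fun_prop
    · exact Filter.Eventually.of_forall fun p => (measurePreserving_sub_right _ _).map_eq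
  convert! h3.comp (hswap.comp (h2.comp h1)) using 1
  funext z
  simp only [dKdVLog, Function.comp, Prod.swap, Prod.mk.injEq]
  constructor <;> ring

lemma measurable_dKdVMap (α β : ℝ≥0) : Measurable (dKdVMap α β) := by
  unfold dKdVMap
  refine Measurable.prodMk (Measurable.subtype_mk ?_) (Measurable.subtype_mk ?_) <;> fun_prop

lemma dKdVMap_expPos (α β : ℝ≥0) (z : ℝ × ℝ) :
    dKdVMap α β (Prod.map expPos expPos z) = Prod.map expPos expPos (dKdVLog α β z) := by
  obtain ⟨ξ, η⟩ := z
  have hp : 0 < (1 + β * Real.exp (ξ + η)) / (1 + α * Real.exp (ξ + η)) := by positivity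
  have hα : 0 < 1 + α * Real.exp (ξ + η) := by positivity
  have hβ : 0 < 1 + β * Real.exp (ξ + η) := by positivity
  refine Prod.ext (Subtype.ext ?_) (Subtype.ext ?_)
  · simp only [dKdVMap, Prod.map, expPos, dKdVLog]
    rw [Real.exp_add η, Real.exp_log hp, mul_assoc, mul_assoc, ← Real.exp_add]
    ring
  · simp only [dKdVMap, Prod.map, expPos, dKdVLog]
    rw [Real.exp_sub ξ, Real.exp_log hp, mul_assoc, mul_assoc, ← Real.exp_add]
    field_simp

lemma gigLogWeight_dKdVLog (α β : ℝ≥0) (l c : ℝ) (z : ℝ × ℝ) :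
    gigLogWeight l (c * α) c (dKdVLog α β z).1 * gigLogWeight l (c * β) c (dKdVLog α β z).2 =
      gigLogWeight l (c * α) c z.1 * gigLogWeight l (c * β) c z.2 := by
  obtain ⟨ξ, η⟩ := z
  have hp : 0 < (1 + β * Real.exp (ξ + η)) / (1 + α * Real.exp (ξ + η)) := by positivity
  have hα : 0 < 1 + α * Real.exp (ξ + η) := by positivity
  have hβ : 0 < 1 + β * Real.exp (ξ + η) := by positivity
  simp only [dKdVLog, gigLogWeight, ← ENNReal.ofReal_mul (Real.exp_pos _).le, ← Real.exp_add]
  congr 2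
  set L := Real.log ((1 + β * Real.exp (ξ + η)) / (1 + α * Real.exp (ξ + η))) with hL
  have hLe : Real.exp L = (1 + β * (Real.exp ξ * Real.exp η)) /
      (1 + α * (Real.exp ξ * Real.exp η)) := by
    rw [hL, Real.exp_log hp, Real.exp_add]
  rw [Real.exp_add] at hα hβ
  simp only [Real.exp_neg, Real.exp_add, Real.exp_sub]
  rw [hLe]
  field_simp
  ring

lemma map_dKdVLog_gigLog (α β : ℝ≥0) (l c : ℝ) :
    ((gigLog l (c * α) c).prod (gigLog l (c * β) c)).map (dKdVLog α β) =
      (gigLog l (c * α) c).prod (gigLog l (c * β) c) := by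
  have hm := measurePreserving_dKdVLog α β
  have m1 := measurable_gigLogWeight l (c * α) c
  have m2 := measurable_gigLogWeight l (c * β) c
  have hW : Measurable fun z : ℝ × ℝ =>
      (∫⁻ ξ, gigLogWeight l (c * α) c ξ)⁻¹ * gigLogWeight l (c * α) c z.1 *
      ((∫⁻ ξ, gigLogWeight l (c * β) c ξ)⁻¹ * gigLogWeight l (c * β) c z.2) := by
    fun_prop
  rw [gigLog, gigLog, prod_withDensity (by fun_prop) (by fun_prop)]
  ext s hs
  rw [Measure.map_apply hm.measurable hs, withDensity_apply _ hs,
    withDensity_apply _ (hm.measurable hs), ← hm.setLIntegral_comp_preimage hs hW]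
  refine lintegral_congr fun z => ?_
  have h := gigLogWeight_dKdVLog α β l c z
  rw [mul_mul_mul_comm, ← h, mul_mul_mul_comm]

theorem detailedBalance_gig {α β : ℝ≥0} {l c : ℝ} (hl : α * β = 0 → 0 < l) (hc : 0 < c) :
    DetailedBalance (dKdVMap α β) (gig l (c * α) c) (gig l (c * β) c) := by
  have hα : c * (α : ℝ) = 0 → 0 < l := fun h => hl (by
    have : α = 0 := by simpa [hc.ne'] using h
    simp [this])
  have hβ : c * (β : ℝ) = 0 → 0 < l := fun h => hl (by
    have : β = 0 := by simpa [hc.ne'] using h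
    simp [this])
  have := isProbabilityMeasure_gigLog (by positivity) hc hα
  have := isProbabilityMeasure_gigLog (by positivity) hc hβ
  refine ⟨isProbabilityMeasure_gig (by positivity) hc hα,
    isProbabilityMeasure_gig (by positivity) hc hβ, ?_⟩
  have he := measurable_expPos.prodMap measurable_expPos
  rw [gig_eq_map, gig_eq_map, Measure.map_prod_map _ _ measurable_expPos measurable_expPos,
    Measure.map_map (measurable_dKdVMap α β) he]
  nth_rewrite 2 [← map_dKdVLog_gigLog]
  rw [Measure.map_map he (measurePreserving_dKdVLog α β).measurable]
  congr 1
  funext z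
  exact dKdVMap_expPos α β z

/-! ### The case α = β -/

lemma dKdVMap_self (α : ℝ≥0) : dKdVMap α α = Prod.swap := by
  funext ⟨⟨x, hx⟩, ⟨u, hu⟩⟩
  have hx : 0 < x := hx
  have hu : 0 < u := hu
  have : 0 < 1 + α * x * u := by positivity
  refine Prod.ext (Subtype.ext ?_) (Subtype.ext ?_) <;> simp only [dKdVMap, Prod.swap] <;>
    field_simp

theorem detailedBalance_dKdVMap_self (α : ℝ≥0) (m : Measure PosReal) [IsProbabilityMeasure m] :
    DetailedBalance (dKdVMap α α) m m :=
  ⟨inferInstance, inferInstance, by rw [dKdVMap_self, Measure.prod_swap]⟩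

/-! ### Uniqueness for Laplace transforms of 1/X -/

/-- The bounded continuous function `x ↦ exp (-1 / x)` on the half-line. -/
noncomputable def expNegInv : BoundedContinuousFunction PosReal ℝ :=
  BoundedContinuousFunction.ofNormedAddCommGroup (fun x => Real.exp (-(x : ℝ)⁻¹))
    (Real.continuous_exp.comp (continuous_subtype_val.inv₀ fun x => (ne_of_gt x.2)).neg) 1
    fun x => by
      rw [Real.norm_of_nonneg (Real.exp_pos _).le, Real.exp_le_one_iff]
      have : (0 : ℝ) < x := x.2
      simpa using this.le

lemma expNegInv_apply (x : PosReal) : expNegInv x = Real.exp (-(x : ℝ)⁻¹) := rfl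

/-- A probability measure on the half-line is determined by the Laplace transform of its image
under inversion. -/
theorem ext_of_integral_exp_neg_inv {μ ν : Measure PosReal} [IsProbabilityMeasure μ]
    [IsProbabilityMeasure ν]
    (h : ∀ s : ℝ, 0 < s → ∫ x, Real.exp (-s * (x : ℝ)⁻¹) ∂μ = ∫ x, Real.exp (-s * (x : ℝ)⁻¹) ∂ν) :
    μ = ν := by
  have : PolishSpace PosReal := isOpen_Ioi.polishSpace
  -- The single function exp(-1/x) separates points, and polynomials in it are combinations of the
  -- exp(-n/x), so integer values of s suffice.
  refine ext_of_forall_mem_subalgebra_integral_eq_of_polish (𝕜 := ℝ)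
    (A := StarAlgebra.adjoin ℝ {expNegInv}) ?_ ?_
  · intro x y hxy
    refine ⟨expNegInv, ⟨expNegInv.toContinuousMap, ⟨expNegInv,
      StarAlgebra.subset_adjoin ℝ _ (Set.mem_singleton _), rfl⟩, rfl⟩, fun he => hxy ?_⟩
    rw [expNegInv_apply, expNegInv_apply] at he
    exact Subtype.ext (inv_injective (neg_injective (Real.exp_injective he)))
  · intro g hg
    have hs : star ({expNegInv} : Set (BoundedContinuousFunction PosReal ℝ)) = {expNegInv} := by
      rw [Set.star_singleton]; congr 1
    rw [← StarSubalgebra.mem_toSubalgebra, StarAlgebra.adjoin_toSubalgebra, hs, Set.union_self,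
      Algebra.adjoin_singleton_eq_range_aeval] at hg
    obtain ⟨p, rfl⟩ := hg
    change ∫ x, (Polynomial.aeval expNegInv p) x ∂μ = ∫ x, (Polynomial.aeval expNegInv p) x ∂ν
    induction p using Polynomial.induction_on' with
    | add p q hp hq =>
      simp only [map_add, BoundedContinuousFunction.add_apply]
      rw [integral_add (BoundedContinuousFunction.integrable _ _)
        (BoundedContinuousFunction.integrable _ _),
        integral_add (BoundedContinuousFunction.integrable _ _)
        (BoundedContinuousFunction.integrable _ _), hp, hq]
    | monomial n a =>
      have key : ∀ x : PosReal, (Polynomial.aeval expNegInv (Polynomial.monomial n a)) x =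
          a * Real.exp (-n * (x : ℝ)⁻¹) := by
        intro x
        rw [Polynomial.aeval_monomial, BoundedContinuousFunction.mul_apply,
          BoundedContinuousFunction.pow_apply, expNegInv_apply, ← Real.exp_nat_mul]
        simp
      simp_rw [key]
      rw [integral_const_mul, integral_const_mul]
      rcases Nat.eq_zero_or_pos n with rfl | hn
      · simp
      · rw [h n (by exact_mod_cast hn)]

lemma integral_pos_of_forall_pos {X : Type*} [MeasurableSpace X] {μ : Measure X} [NeZero μ]
    {f : X → ℝ} (hf : Integrable f μ) (hpos : ∀ x, 0 < f x) : 0 < ∫ x, f x ∂μ := by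
  rw [integral_pos_iff_support_of_nonneg (fun x => (hpos x).le) hf,
    Function.support_eq_univ fun x => (hpos x).ne', pos_iff_ne_zero]
  exact Measure.measure_univ_ne_zero.2 (NeZero.ne μ)

lemma eq_dirac_of_ae_eq {X : Type*} [MeasurableSpace X] {μ : Measure X} [IsProbabilityMeasure μ]
    {x₀ : X} (h : ∀ᵐ x ∂μ, x = x₀) : μ = Measure.dirac x₀ := by
  calc μ = μ.map id := Measure.map_id.symm
    _ = μ.map (fun _ => x₀) := Measure.map_congr h
    _ = Measure.dirac x₀ := by rw [Measure.map_const, measure_univ, one_smul]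

/-- For t < 0 the tilt exp(t/x) is bounded, so all tilted moments exist and differentiation under
the integral is allowed without any moment assumption on μ. -/
lemma mem_interior_integrableExpSet_inv {μ : Measure PosReal} [IsProbabilityMeasure μ] {t : ℝ}
    (ht : t < 0) : t ∈ interior (integrableExpSet (fun x : PosReal => (x : ℝ)⁻¹) μ) := by
  refine interior_maximal (s := integrableExpSet (fun x : PosReal => (x : ℝ)⁻¹) μ)
    (t := Set.Iio 0) ?_ isOpen_Iio ht
  intro s hs
  refine Integrable.of_bound (C := 1) (by fun_prop) (Filter.Eventually.of_forall fun x => ?_)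
  have hx : (0 : ℝ) < (x : ℝ)⁻¹ := inv_pos.2 x.2
  have hs : s < 0 := hs
  rw [Real.norm_of_nonneg (Real.exp_pos _).le, Real.exp_le_one_iff]
  nlinarith

/-! ### Tilted moments and elimination of ν -/

/-- The tilted moments `E[X⁻ⁿ exp (t X⁻¹)]`. -/
noncomputable def invMoment (μ : Measure PosReal) (n : ℕ) (t : ℝ) : ℝ :=
  ∫ x, (x : ℝ)⁻¹ ^ n * Real.exp (t * (x : ℝ)⁻¹) ∂μ

/-- The tilted moments `E[U⁻ⁿ exp (s β U + t U⁻¹)]`. -/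
noncomputable def invMoment₂ (β : ℝ≥0) (ν : Measure PosReal) (n : ℕ) (s t : ℝ) : ℝ :=
  ∫ u, (u : ℝ)⁻¹ ^ n * Real.exp (s * (β * u) + t * (u : ℝ)⁻¹) ∂ν

lemma DetailedBalance.integral_comp_dKdVMap {β : ℝ≥0} {μ ν : Measure PosReal}
    (h : DetailedBalance (dKdVMap 0 β) μ ν) {g : PosReal × PosReal → ℝ} (hg : Measurable g) :
    ∫ p, g (dKdVMap 0 β p) ∂(μ.prod ν) = ∫ p, g p ∂(μ.prod ν) := by
  conv_rhs => rw [← h.map_eq]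
  rw [integral_map (measurable_dKdVMap 0 β).aemeasurable hg.aestronglyMeasurable]

section Moments

variable {μ ν : Measure PosReal} [IsProbabilityMeasure μ] [IsProbabilityMeasure ν]

lemma integrable_invMoment (n : ℕ) {t : ℝ} (ht : t < 0) :
    Integrable (fun x : PosReal => (x : ℝ)⁻¹ ^ n * Real.exp (t * (x : ℝ)⁻¹)) μ :=
  integrable_pow_mul_exp_of_mem_interior_integrableExpSet (mem_interior_integrableExpSet_inv ht) n

lemma hasDerivAt_invMoment (n : ℕ) {t : ℝ} (ht : t < 0) :
    HasDerivAt (invMoment μ n) (invMoment μ (n + 1) t) t :=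
  hasDerivAt_integral_pow_mul_exp_real (mem_interior_integrableExpSet_inv ht) n

lemma invMoment_pos (n : ℕ) {t : ℝ} (ht : t < 0) : 0 < invMoment μ n t :=
  integral_pos_of_forall_pos (integrable_invMoment n ht) fun x => by
    have hx : (0 : ℝ) < x := x.2
    positivity

lemma tendsto_invMoment_zero :
    Filter.Tendsto (invMoment μ 0) (nhdsWithin 0 (Set.Iio 0)) (nhds 1) := by
  have h1 : ∫ x : PosReal, (1 : ℝ) ∂μ = 1 := by simp
  rw [← h1]
  refine tendsto_integral_filter_of_dominated_convergence (fun _ => 1)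
    (Filter.Eventually.of_forall fun t => by fun_prop) ?_ (integrable_const _)
    (Filter.Eventually.of_forall fun x => ?_)
  · filter_upwards [self_mem_nhdsWithin] with t ht
    refine Filter.Eventually.of_forall fun x => ?_
    have hx : (0 : ℝ) < (x : ℝ)⁻¹ := inv_pos.2 x.2
    have ht : t < 0 := ht
    rw [pow_zero, one_mul, Real.norm_of_nonneg (Real.exp_pos _).le, Real.exp_le_one_iff]
    nlinarith
  · have : Continuous fun t : ℝ => (x : ℝ)⁻¹ ^ 0 * Real.exp (t * (x : ℝ)⁻¹) := by fun_prop
    simpa using (this.tendsto 0).mono_left nhdsWithin_le_nhds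

lemma integrable_invMoment₂ (β : ℝ≥0) (n : ℕ) {s t : ℝ} (hs : s < 0) (ht : t < 0) :
    Integrable (fun u : PosReal => (u : ℝ)⁻¹ ^ n * Real.exp (s * (β * u) + t * (u : ℝ)⁻¹)) ν := by
  refine (integrable_invMoment (μ := ν) n ht).mono (by fun_prop)
    (Filter.Eventually.of_forall fun u => ?_)
  have hu : (0 : ℝ) < u := u.2
  have hb : 0 ≤ (β : ℝ) * u := by positivity
  rw [Real.norm_of_nonneg (by positivity), Real.norm_of_nonneg (by positivity)]
  gcongr
  nlinarith

lemma invMoment₂_pos (β : ℝ≥0) (n : ℕ) {s t : ℝ} (hs : s < 0) (ht : t < 0) :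
    0 < invMoment₂ β ν n s t :=
  integral_pos_of_forall_pos (integrable_invMoment₂ β n hs ht) fun x => by
    have hx : (0 : ℝ) < x := x.2
    positivity

/-- The integrand whose integral over `μ × ν` is `invMoment μ i s * invMoment₂ β ν j s t`. -/
noncomputable def tiltedMonomial (β : ℝ≥0) (i j : ℕ) (s t : ℝ) (p : PosReal × PosReal) : ℝ :=
  ((p.1 : ℝ)⁻¹ ^ i * Real.exp (s * (p.1 : ℝ)⁻¹)) *
    ((p.2 : ℝ)⁻¹ ^ j * Real.exp (s * (β * p.2) + t * (p.2 : ℝ)⁻¹))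

lemma measurable_tiltedMonomial (β : ℝ≥0) (i j : ℕ) (s t : ℝ) :
    Measurable (tiltedMonomial β i j s t) := by
  unfold tiltedMonomial; fun_prop

lemma integral_tiltedMonomial (β : ℝ≥0) (i j : ℕ) (s t : ℝ) :
    ∫ p, tiltedMonomial β i j s t p ∂(μ.prod ν) = invMoment μ i s * invMoment₂ β ν j s t :=
  integral_prod_mul (μ := μ) (ν := ν)
    (fun x : PosReal => (x : ℝ)⁻¹ ^ i * Real.exp (s * (x : ℝ)⁻¹))
    (fun u : PosReal => (u : ℝ)⁻¹ ^ j * Real.exp (s * (β * u) + t * (u : ℝ)⁻¹))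

lemma integrable_tiltedMonomial (β : ℝ≥0) (i j : ℕ) {s t : ℝ} (hs : s < 0) (ht : t < 0) :
    Integrable (tiltedMonomial β i j s t) (μ.prod ν) :=
  (integrable_invMoment i hs).mul_prod (integrable_invMoment₂ β j hs ht)

/-- These relations make the map exchange s and t in the exponent s(1/x + βu) + t/u, and preserve
powers of 1/(xu). -/
lemma dKdVMap_zero_relations (β : ℝ≥0) (p : PosReal × PosReal) :
    (((dKdVMap 0 β p).1 : ℝ)⁻¹ * ((dKdVMap 0 β p).2 : ℝ)⁻¹ = (p.1 : ℝ)⁻¹ * (p.2 : ℝ)⁻¹) ∧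
    ((dKdVMap 0 β p).2 : ℝ)⁻¹ = (p.1 : ℝ)⁻¹ + β * p.2 ∧
    ((dKdVMap 0 β p).1 : ℝ)⁻¹ + β * (dKdVMap 0 β p).2 = (p.2 : ℝ)⁻¹ := by
  obtain ⟨⟨x, hx⟩, ⟨u, hu⟩⟩ := p
  have hx : 0 < x := hx
  have hu : 0 < u := hu
  have : 0 < 1 + β * x * u := by positivity
  simp only [dKdVMap, NNReal.coe_zero, zero_mul, add_zero, div_one, mul_one]
  refine ⟨?_, ?_, ?_⟩ <;> field_simp

lemma tiltedMonomial_self_dKdVMap (β : ℝ≥0) (i : ℕ) (s t : ℝ) (p : PosReal × PosReal) :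
    tiltedMonomial β i i s t (dKdVMap 0 β p) = tiltedMonomial β i i t s p := by
  obtain ⟨h1, h2, h3⟩ := dKdVMap_zero_relations β p
  simp only [tiltedMonomial]
  rw [mul_mul_mul_comm, ← mul_pow, h1, ← Real.exp_add, mul_mul_mul_comm (_ ^ i), ← mul_pow,
    ← Real.exp_add, ← add_assoc, ← mul_add, h3, h2]
  congr 2; ring

/-- The additional factor 1/v = 1/x + βu breaks the symmetry in s and t; its term βu cancels one
1/u. This is the source of the differential equation. -/
lemma tiltedMonomial_one_two_dKdVMap (β : ℝ≥0) (s t : ℝ) (p : PosReal × PosReal) :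
    tiltedMonomial β 1 2 s t (dKdVMap 0 β p) =
      tiltedMonomial β 2 1 t s p + β * tiltedMonomial β 1 0 t s p := by
  have h0 := tiltedMonomial_self_dKdVMap β 1 s t p
  have h2 := (dKdVMap_zero_relations β p).2.1
  have hx : (0 : ℝ) < p.1 := p.1.2
  have hu : (0 : ℝ) < p.2 := p.2.2
  calc tiltedMonomial β 1 2 s t (dKdVMap 0 β p)
      = tiltedMonomial β 1 1 s t (dKdVMap 0 β p) * ((dKdVMap 0 β p).2 : ℝ)⁻¹ := by
        simp only [tiltedMonomial]; ring
    _ = _ := by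
        rw [h0, h2]
        simp only [tiltedMonomial]
        field_simp

variable {β : ℝ≥0}

lemma DetailedBalance.invMoment_mul_self (h : DetailedBalance (dKdVMap 0 β) μ ν) (i : ℕ)
    (s t : ℝ) : invMoment μ i s * invMoment₂ β ν i s t = invMoment μ i t * invMoment₂ β ν i t s := by
  rw [← integral_tiltedMonomial, ← integral_tiltedMonomial,
    ← h.integral_comp_dKdVMap (measurable_tiltedMonomial _ _ _ _ _)]
  simp_rw [tiltedMonomial_self_dKdVMap]

lemma DetailedBalance.invMoment_one_mul_two (h : DetailedBalance (dKdVMap 0 β) μ ν)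
    {s t : ℝ} (hs : s < 0) (ht : t < 0) :
    invMoment μ 1 s * invMoment₂ β ν 2 s t =
      invMoment μ 2 t * invMoment₂ β ν 1 t s + β * (invMoment μ 1 t * invMoment₂ β ν 0 t s) := by
  simp_rw [← integral_tiltedMonomial]
  rw [← h.integral_comp_dKdVMap (measurable_tiltedMonomial _ _ _ _ _)]
  simp_rw [tiltedMonomial_one_two_dKdVMap]
  rw [integral_add (integrable_tiltedMonomial _ _ _ ht hs)
    ((integrable_tiltedMonomial _ _ _ ht hs).const_mul _), integral_const_mul]

lemma DetailedBalance.invMoment_ratio_eq (h : DetailedBalance (dKdVMap 0 β) μ ν) (hβ : 0 < β)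
    {s t : ℝ} (hs : s < 0) (ht : t < 0) :
    invMoment μ 0 s * invMoment μ 2 s * invMoment μ 1 t ^ 2 =
      invMoment μ 0 t * invMoment μ 2 t * invMoment μ 1 s ^ 2 := by
  have h0 := h.invMoment_mul_self 0 s t
  have h1 := h.invMoment_mul_self 1 s t
  have h2 := h.invMoment_mul_self 2 s t
  have hst := h.invMoment_one_mul_two hs ht
  have hts := h.invMoment_one_mul_two ht hs
  have hP : (β : ℝ) * (invMoment μ 0 s * invMoment₂ β ν 0 s t) ≠ 0 :=
    mul_ne_zero (by exact_mod_cast hβ.ne')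
      (mul_pos (invMoment_pos 0 hs) (invMoment₂_pos β 0 hs ht)).ne'
  -- Scale `hst` and `hts` so that `h2` identifies their left sides; the first moments of ν then
  -- cancel by `h1`. Below, `h0` removes the remaining zeroth moments.
  have e1 : β * invMoment μ 2 s * invMoment μ 1 t ^ 2 * invMoment₂ β ν 0 t s =
      β * invMoment μ 1 s ^ 2 * invMoment μ 2 t * invMoment₂ β ν 0 s t := by
    linear_combination -(invMoment μ 2 s * invMoment μ 1 t) * hst +
      (invMoment μ 2 t * invMoment μ 1 s) * hts + invMoment μ 1 s * invMoment μ 1 t * h2 +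
      invMoment μ 2 s * invMoment μ 2 t * h1
  refine mul_left_cancel₀ hP ?_
  linear_combination invMoment μ 0 s * invMoment μ 0 t * e1 +
    β * invMoment μ 0 s * invMoment μ 2 s * invMoment μ 1 t ^ 2 * h0

end Moments

/-! ### The differential equation and the law of the first marginal -/

lemma exists_eq_const_of_hasDerivAt_zero {g : ℝ → ℝ} (h : ∀ t < 0, HasDerivAt g 0 t) :
    ∃ C, ∀ t < 0, g t = C :=
  ⟨g (-1), fun _ ht => isOpen_Iio.is_const_of_deriv_eq_zero (isPreconnected_Iio (a := (0 : ℝ)))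
    (fun t ht => (h t ht).differentiableAt.differentiableWithinAt) (fun t ht => (h t ht).deriv)
    ht (by norm_num)⟩

/-- The solutions of `f f'' = κ f' ^ 2` on `(-∞, 0)`, with `κ > 1`. -/
lemma exists_eq_rpow_of_mul_deriv_deriv_eq {f f₁ f₂ : ℝ → ℝ} {κ : ℝ} (hκ : 1 < κ)
    (hf : ∀ t < 0, HasDerivAt f (f₁ t) t) (hf₁ : ∀ t < 0, HasDerivAt f₁ (f₂ t) t)
    (hpos : ∀ t < 0, 0 < f t) (hpos₁ : ∀ t < 0, 0 < f₁ t)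
    (heq : ∀ t < 0, f t * f₂ t = κ * f₁ t ^ 2)
    (hlim : Filter.Tendsto f (nhdsWithin 0 (Set.Iio 0)) (nhds 1)) :
    ∃ l c : ℝ, 0 < l ∧ 0 < c ∧ ∀ t < 0, f t = (c / (c - t)) ^ l := by
  have hκ' : 0 < κ - 1 := sub_pos.2 hκ
  -- The equation says (f/f')' = 1 - κ.
  obtain ⟨d, hd⟩ : ∃ d, ∀ t < 0, f t / f₁ t + (κ - 1) * t = d := by
    refine exists_eq_const_of_hasDerivAt_zero fun t ht => ?_
    have hne := (hpos₁ t ht).ne'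
    convert! ((hf t ht).div (hf₁ t ht) hne).add ((hasDerivAt_id t).const_mul (κ - 1)) using 1
    rw [heq t ht]
    field_simp
    ring
  -- Otherwise f/f' would vanish at the negative point d/(κ - 1).
  have hd0 : 0 ≤ d := by
    by_contra! hneg
    have ht : d / (κ - 1) < 0 := div_neg_of_neg_of_pos hneg hκ'
    have h1 := hd _ ht
    have h2 := div_pos (hpos _ ht) (hpos₁ _ ht)
    rw [mul_div_cancel₀ _ hκ'.ne'] at h1
    linarith
  set l := 1 / (κ - 1) with hl
  have hl0 : 0 < l := by positivity
  set c := d * l with hc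
  have hc0 : 0 ≤ c := by positivity
  have hf₁eq : ∀ t < 0, f₁ t * (c - t) = l * f t := by
    intro t ht
    have h1 := hd t ht
    have hne := (hpos₁ t ht).ne'
    rw [hc, ← h1, hl]
    field_simp
    ring
  obtain ⟨C, hC⟩ : ∃ C, ∀ t < 0, f t * (c - t) ^ l = C := by
    refine exists_eq_const_of_hasDerivAt_zero fun t ht => ?_
    have hct : 0 < c - t := by linarith
    convert! (hf t ht).mul (((hasDerivAt_id t).const_sub c).rpow_const (p := l)
      (Or.inl hct.ne')) using 1
    rw [id, Real.rpow_sub_one hct.ne', eq_div_of_mul_eq hct.ne' (hf₁eq t ht)]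
    ring
  have hClim : Filter.Tendsto (fun t => f t * (c - t) ^ l) (nhdsWithin 0 (Set.Iio 0))
      (nhds (1 * (c - 0) ^ l)) := by
    refine hlim.mul (Filter.Tendsto.rpow_const ?_ (Or.inr hl0.le))
    exact (tendsto_const_nhds.sub Filter.tendsto_id).mono_left nhdsWithin_le_nhds
  have hCc : c ^ l = C := by
    have h2 : Filter.Tendsto (fun t => f t * (c - t) ^ l) (nhdsWithin 0 (Set.Iio 0)) (nhds C) := by
      refine tendsto_const_nhds.congr' ?_
      filter_upwards [self_mem_nhdsWithin] with t ht using (hC t ht).symm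
    simpa using tendsto_nhds_unique hClim h2
  have hC0 : 0 < C := by
    rw [← hC (-1) (by norm_num)]
    exact mul_pos (hpos _ (by norm_num)) (Real.rpow_pos_of_pos (by linarith) _)
  -- If c = 0, then f(t)(-t)^l is a positive constant, yet it tends to 0 as t increases to 0 because
  -- f tends to 1.
  have hcpos : 0 < c := by
    refine lt_of_le_of_ne hc0 fun h => ?_
    rw [← h, Real.zero_rpow hl0.ne'] at hCc
    exact hC0.ne hCc
  refine ⟨l, c, hl0, hcpos, fun t ht => ?_⟩
  have hct : 0 < c - t := by linarith
  rw [Real.div_rpow hc0 hct.le, hCc, ← hC t ht, mul_div_cancel_right₀]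
  exact (Real.rpow_pos_of_pos hct _).ne'

/-- Tilting by exp(t/x) replaces c by c - t, so the integral is a ratio of two Gamma normalizations.
-/
lemma integral_exp_inv_gig {l c t : ℝ} (hl : 0 < l) (hc : 0 < c) (ht : t < 0) :
    ∫ x, Real.exp (t * (x : ℝ)⁻¹) ∂(gig l 0 c) = (c / (c - t)) ^ l := by
  have hct : 0 < c - t := by linarith
  have hG := Real.Gamma_pos_of_pos hl
  rw [integral_eq_lintegral_of_nonneg_ae (Filter.Eventually.of_forall fun x => (Real.exp_pos _).le)
    (by fun_prop), gig_eq_map, lintegral_map (by fun_prop) measurable_expPos, gigLog,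
    lintegral_withDensity_eq_lintegral_mul _
      ((measurable_gigLogWeight _ _ _).const_mul _)
      (by unfold expPos; fun_prop)]
  have key : ∀ ξ, gigLogWeight l 0 c ξ * ENNReal.ofReal (Real.exp (t * (expPos ξ : ℝ)⁻¹)) =
      gigLogWeight l 0 (c - t) ξ := by
    intro ξ
    have : ((expPos ξ : PosReal) : ℝ) = Real.exp ξ := rfl
    rw [this, gigLogWeight, gigLogWeight, ← ENNReal.ofReal_mul (Real.exp_pos _).le,
      ← Real.exp_add, ← Real.exp_neg]
    congr 2; ring
  simp only [Pi.mul_apply, mul_assoc, key]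
  rw [lintegral_const_mul _ (measurable_gigLogWeight _ _ _),
    lintegral_gigLogWeight_zero_right hl hc, lintegral_gigLogWeight_zero_right hl hct,
    ← ENNReal.ofReal_inv_of_pos (by positivity), ← ENNReal.ofReal_mul (by positivity),
    ENNReal.toReal_ofReal (by positivity), Real.div_rpow hc.le hct.le,
    Real.div_rpow zero_le_one hc.le, Real.div_rpow zero_le_one hct.le, Real.one_rpow]
  field_simp

/-- In the case `α = 0`, the first marginal is degenerate or an inverse gamma distribution. -/
theorem DetailedBalance.left_eq_dirac_or_eq_gig {β : ℝ≥0} {μ ν : Measure PosReal}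
    (h : DetailedBalance (dKdVMap 0 β) μ ν) (hβ : 0 < β) :
    (∃ x₀, μ = Measure.dirac x₀) ∨ ∃ l c : ℝ, 0 < l ∧ 0 < c ∧ μ = gig l 0 c := by
  have := h.isProbabilityMeasure_left
  have := h.isProbabilityMeasure_right
  have h1 : (-1 : ℝ) < 0 := by norm_num
  have p0 := invMoment_pos (μ := μ) 0 h1
  have p1 := invMoment_pos (μ := μ) 1 h1
  have i0 := integrable_invMoment (μ := μ) 0 h1
  have i1 := integrable_invMoment (μ := μ) 1 h1
  have i2 := integrable_invMoment (μ := μ) 2 h1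
  set κ := invMoment μ 0 (-1) * invMoment μ 2 (-1) / invMoment μ 1 (-1) ^ 2 with hκ
  rcases le_or_gt κ 1 with hk | hk
  · left
    -- `m` is the mean of 1/X under μ tilted by exp(-1/x). The integral of `g` is the tilted
    -- variance up to a positive factor, and κ ≤ 1 makes it nonpositive.
    set m := invMoment μ 1 (-1) / invMoment μ 0 (-1) with hm
    set g : PosReal → ℝ := fun x => ((x : ℝ)⁻¹ - m) ^ 2 * Real.exp (-1 * (x : ℝ)⁻¹) with hg
    have hg_eq : g = fun x : PosReal => ((x : ℝ)⁻¹ ^ 2 * Real.exp (-1 * (x : ℝ)⁻¹) -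
        2 * m * ((x : ℝ)⁻¹ ^ 1 * Real.exp (-1 * (x : ℝ)⁻¹))) +
        m ^ 2 * ((x : ℝ)⁻¹ ^ 0 * Real.exp (-1 * (x : ℝ)⁻¹)) := by
      funext x; simp only [hg]; ring
    have hgi : Integrable g μ := by
      rw [hg_eq]; exact (i2.sub (i1.const_mul _)).add (i0.const_mul _)
    have hg0 : 0 ≤ g := fun x => by positivity
    have hint : ∫ x, g x ∂μ = invMoment μ 2 (-1) - 2 * m * invMoment μ 1 (-1) +
        m ^ 2 * invMoment μ 0 (-1) := by
      have i12 : Integrable (fun x : PosReal => (x : ℝ)⁻¹ ^ 2 * Real.exp (-1 * (x : ℝ)⁻¹) -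
          2 * m * ((x : ℝ)⁻¹ ^ 1 * Real.exp (-1 * (x : ℝ)⁻¹))) μ := i2.sub (i1.const_mul _)
      simp only [hg_eq]
      rw [integral_add i12 (i0.const_mul _), integral_sub i2 (i1.const_mul _),
        integral_const_mul, integral_const_mul]
      rfl
    have hle : ∫ x, g x ∂μ ≤ 0 := by
      rw [hκ, div_le_one (by positivity)] at hk
      have : ∫ x, g x ∂μ = (invMoment μ 0 (-1) * invMoment μ 2 (-1) - invMoment μ 1 (-1) ^ 2) /
          invMoment μ 0 (-1) := by
        rw [hint, hm]; field_simp; ring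
      rw [this]
      exact div_nonpos_of_nonpos_of_nonneg (by linarith) p0.le
    have hz := (integral_eq_zero_iff_of_nonneg hg0 hgi).1 (le_antisymm hle (integral_nonneg hg0))
    have hxm : ∀ᵐ x : PosReal ∂μ, (x : ℝ)⁻¹ = m := by
      filter_upwards [hz] with x hx
      have := (mul_eq_zero.1 hx).resolve_right (Real.exp_pos _).ne'
      exact sub_eq_zero.1 (pow_eq_zero_iff two_ne_zero |>.1 this)
    obtain ⟨x₀, hx₀⟩ := hxm.exists
    refine ⟨x₀, eq_dirac_of_ae_eq ?_⟩
    filter_upwards [hxm] with x hx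
    exact Subtype.ext (inv_injective (hx.trans hx₀.symm))
  · right
    obtain ⟨l, c, hl, hc, hlc⟩ := exists_eq_rpow_of_mul_deriv_deriv_eq (f := invMoment μ 0)
      (f₁ := invMoment μ 1) (f₂ := invMoment μ 2) hk
      (fun t ht => hasDerivAt_invMoment 0 ht) (fun t ht => hasDerivAt_invMoment 1 ht)
      (fun t ht => invMoment_pos 0 ht) (fun t ht => invMoment_pos 1 ht)
      (fun t ht => by
        have := h.invMoment_ratio_eq hβ ht h1
        rw [hκ]
        field_simp
        linear_combination this) tendsto_invMoment_zero
    have := isProbabilityMeasure_gig (l := l) (c₁ := 0) le_rfl hc fun _ => hl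
    refine ⟨l, c, hl, hc, ext_of_integral_exp_neg_inv fun s hs => ?_⟩
    have hs' : -s < 0 := by linarith
    rw [integral_exp_inv_gig hl hc hs', ← hlc _ hs']
    simp [invMoment]

/-! ### Uniqueness of the second marginal -/

/-- If the transition probabilities of a Markov kernel are pairwise not mutually singular,
then it has at most one invariant probability measure. -/
theorem eq_of_invariant_of_not_mutuallySingular {X : Type*} [MeasurableSpace X]
    {κ : X → Measure X} (hκ : Measurable κ) [∀ x, IsProbabilityMeasure (κ x)]
    (hsing : ∀ x y, ¬ (κ x).MutuallySingular (κ y)) {ν ν' : Measure X} [IsProbabilityMeasure ν]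
    [IsProbabilityMeasure ν'] (hν : ν.bind κ = ν) (hν' : ν'.bind κ = ν') : ν = ν' := by
  -- Below, ρ and ρ' are the positive and negative parts of ν - ν', carried by s and its complement.
  obtain ⟨s, hs⟩ := exists_isHahnDecomposition ν' ν
  have hsm := hs.measurableSet
  set ρ := ν.restrict s - ν'.restrict s
  set ρ' := ν'.restrict sᶜ - ν.restrict sᶜ
  have hρ : ρ + ν'.restrict s = ν.restrict s := Measure.sub_add_cancel_of_le hs.le_on
  have hρ' : ρ' + ν.restrict sᶜ = ν'.restrict sᶜ := Measure.sub_add_cancel_of_le hs.ge_on_compl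
  set f : X → ℝ≥0∞ := fun x => κ x s
  have hf : Measurable f := (Measure.measurable_coe hsm).comp hκ
  have hf1 (x) : f x ≤ 1 := prob_le_one
  have hfin (m : Measure X) [IsFiniteMeasure m] : ∫⁻ x, f x ∂m ≠ ⊤ := by
    refine ne_top_of_le_ne_top (measure_ne_top m Set.univ) ?_
    simpa using lintegral_mono (μ := m) hf1
  have eν : ν s = ∫⁻ x, f x ∂ν := by
    conv_lhs => rw [← hν, Measure.bind_apply hsm hκ.aemeasurable]
  have eν' : ν' s = ∫⁻ x, f x ∂ν' := by
    conv_lhs => rw [← hν', Measure.bind_apply hsm hκ.aemeasurable]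
  have hu : ρ Set.univ + ν' s = ν s := by
    have := congrArg (fun m : Measure X => m Set.univ) hρ
    simpa using this
  have hu' : ρ' Set.univ + ν sᶜ = ν' sᶜ := by
    have := congrArg (fun m : Measure X => m Set.univ) hρ'
    simpa using this
  have huniv : ρ Set.univ = ρ' Set.univ := by
    have t1 := measure_add_measure_compl (μ := ν) hsm
    have t2 := measure_add_measure_compl (μ := ν') hsm
    rw [measure_univ] at t1 t2
    rw [← hu, ← t2, ← hu'] at t1
    have : (ν' s + ν sᶜ) + ρ Set.univ = (ν' s + ν sᶜ) + ρ' Set.univ := by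
      calc _ = ρ Set.univ + ν' s + ν sᶜ := by ring
        _ = _ := t1
        _ = _ := by ring
    exact (ENNReal.add_right_inj (ENNReal.add_ne_top.2
      ⟨measure_ne_top _ _, measure_ne_top _ _⟩)).1 this
  -- This is invariance of ν - ν' evaluated on s. Since κ x s ≤ 1, it forces κ x s = 1 for ρ-almost
  -- every x and κ y s = 0 for ρ'-almost every y. If ρ ≠ 0, such x and y exist and s separates their
  -- transition laws.
  have hbal : ρ Set.univ + ∫⁻ x, f x ∂ρ' = ∫⁻ x, f x ∂ρ := by
    have d1 : ∫⁻ x, f x ∂ν =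
        ∫⁻ x, f x ∂ρ + ∫⁻ x, f x ∂(ν'.restrict s) + ∫⁻ x, f x ∂(ν.restrict sᶜ) := by
      rw [← lintegral_add_measure, hρ, lintegral_add_compl f hsm]
    have d2 : ∫⁻ x, f x ∂ν' =
        ∫⁻ x, f x ∂(ν'.restrict s) + (∫⁻ x, f x ∂ρ' + ∫⁻ x, f x ∂(ν.restrict sᶜ)) := by
      rw [← lintegral_add_measure (μ := ρ'), hρ', lintegral_add_compl f hsm]
    rw [eν, eν', d1, d2] at hu
    refine (ENNReal.add_right_inj (ENNReal.add_ne_top.2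
      ⟨hfin (ν'.restrict s), hfin (ν.restrict sᶜ)⟩)).1 ?_
    calc _ = _ := by ring
      _ = _ := hu
      _ = _ := by ring
  have hle : ∫⁻ x, f x ∂ρ ≤ ρ Set.univ := by simpa using lintegral_mono (μ := ρ) hf1
  have hz' : ∫⁻ x, f x ∂ρ' = 0 := by
    have : ρ Set.univ + ∫⁻ x, f x ∂ρ' ≤ ρ Set.univ + 0 := by rw [hbal, add_zero]; exact hle
    exact nonpos_iff_eq_zero.1 ((ENNReal.add_le_add_iff_left (measure_ne_top ρ _)).1 this)
  have hz : ∫⁻ x, κ x sᶜ ∂ρ = 0 := by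
    rw [hz', add_zero] at hbal
    have hadd : ∫⁻ x, f x ∂ρ + ∫⁻ x, κ x sᶜ ∂ρ = ρ Set.univ := by
      rw [← lintegral_add_left hf]
      simp [f, measure_add_measure_compl hsm]
    rw [← hbal] at hadd
    exact (ENNReal.add_right_inj (measure_ne_top ρ Set.univ)).1 (hadd.trans (add_zero _).symm)
  have hρ0 : ρ Set.univ = 0 := by
    by_contra hne
    have n1 : NeZero ρ := ⟨fun h => hne (by simp [h])⟩
    have n2 : NeZero ρ' := ⟨fun h => hne (by rw [huniv]; simp [h])⟩
    obtain ⟨x, hx⟩ := ((lintegral_eq_zero_iff ((Measure.measurable_coe hsm.compl).comp hκ)).1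
      hz).exists
    obtain ⟨y, hy⟩ := ((lintegral_eq_zero_iff hf).1 hz').exists
    exact hsing y x ⟨s, hsm, hy, hx⟩
  have hρ'0 : ρ' = 0 := Measure.measure_univ_eq_zero.1 (huniv ▸ hρ0)
  rw [Measure.measure_univ_eq_zero.1 hρ0, zero_add] at hρ
  rw [hρ'0, zero_add] at hρ'
  rw [← Measure.restrict_add_restrict_compl (μ := ν) hsm, ← hρ, hρ',
    Measure.restrict_add_restrict_compl hsm]

/-- A differentiable map sends null sets to null sets, and ξ ↦ exp(-ξ) + b maps onto (b, ∞). -/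
lemma ae_of_ae_exp_neg_add {P : ℝ → Prop} {b : ℝ} (h : ∀ᵐ ξ : ℝ, P (Real.exp (-ξ) + b)) :
    ∀ᵐ a : ℝ, b < a → P a := by
  have h0 : volume {ξ : ℝ | ¬ P (Real.exp (-ξ) + b)} = 0 := h
  have hd : DifferentiableOn ℝ (fun ξ : ℝ => Real.exp (-ξ) + b)
      {ξ : ℝ | ¬ P (Real.exp (-ξ) + b)} := by fun_prop
  refine measure_mono_null ?_
    (addHaar_image_eq_zero_of_differentiableOn_of_addHaar_eq_zero volume hd h0)
  intro a ha
  obtain ⟨hba, hPa⟩ := Classical.not_imp.1 ha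
  have e : Real.exp (-(-Real.log (a - b))) + b = a := by
    rw [neg_neg, Real.exp_log (sub_pos.2 hba)]; ring
  exact ⟨-Real.log (a - b), by rwa [Set.mem_ofPred_eq, e], e⟩

lemma ae_expPos_of_ae_gig {l c₁ c₂ : ℝ} (h₁ : 0 ≤ c₁) (h₂ : 0 < c₂) (hl : c₁ = 0 → 0 < l)
    {P : PosReal → Prop} (h : ∀ᵐ x ∂(gig l c₁ c₂), P x) : ∀ᵐ ξ : ℝ, P (expPos ξ) := by
  rw [gig_eq_map] at h
  have h := ae_of_ae_map measurable_expPos.aemeasurable h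
  rw [gigLog, ae_withDensity_iff ((measurable_gigLogWeight _ _ _).const_mul _)] at h
  filter_upwards [h] with ξ hξ
  exact hξ (mul_ne_zero (ENNReal.inv_ne_zero.2 (lintegral_gigLogWeight_ne_top h₁ h₂ hl))
    (ENNReal.ofReal_pos.2 (Real.exp_pos _)).ne')

lemma measurable_map_dKdVMap_snd (β : ℝ≥0) (μ : Measure PosReal) [IsProbabilityMeasure μ] :
    Measurable fun u => μ.map fun x => (dKdVMap 0 β (x, u)).2 := by
  have hF := (measurable_dKdVMap 0 β).snd
  refine Measure.measurable_of_measurable_coe _ fun s hs => ?_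
  have hF' (u : PosReal) : Measurable fun x => (dKdVMap 0 β (x, u)).2 :=
    hF.comp (measurable_id.prodMk measurable_const)
  simp_rw [fun u => Measure.map_apply (μ := μ) (hF' u) hs]
  exact measurable_measure_prodMk_right (hF hs)

/-- Taking second marginals in detailed balance shows that ν is stationary for the kernel u ↦ law of
v. -/
lemma DetailedBalance.bind_eq_right {β : ℝ≥0} {μ ν : Measure PosReal}
    (h : DetailedBalance (dKdVMap 0 β) μ ν) :
    ν.bind (fun u => μ.map fun x => (dKdVMap 0 β (x, u)).2) = ν := by
  have := h.isProbabilityMeasure_left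
  have := h.isProbabilityMeasure_right
  have hF := (measurable_dKdVMap 0 β).snd
  have hF' (u : PosReal) : Measurable fun x => (dKdVMap 0 β (x, u)).2 :=
    hF.comp (measurable_id.prodMk measurable_const)
  ext s hs
  rw [Measure.bind_apply hs (measurable_map_dKdVMap_snd β μ).aemeasurable]
  simp_rw [fun u => Measure.map_apply (μ := μ) (hF' u) hs]
  have h1 : μ.prod ν ((fun p => (dKdVMap 0 β p).2) ⁻¹' s) = ν s := by
    have := congrArg (fun m : Measure (PosReal × PosReal) => m (Prod.snd ⁻¹' s)) h.map_eq
    simp only [Measure.map_apply (measurable_dKdVMap 0 β) (measurable_snd hs)] at this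
    rw [Set.preimage_preimage, ← Set.univ_prod, Measure.prod_prod, measure_univ, one_mul] at this
    exact this
  rw [← h1, Measure.prod_apply_symm (hF hs)]
  rfl

/-- Since 1/v = 1/X + βu with X of positive density, a null set for the law of v contains 1/a for
almost no a > βu. A separating set and its complement would together miss almost all of the ray
above max(βu, βw). -/
lemma not_mutuallySingular_map_dKdVMap_snd (β : ℝ≥0) {l c : ℝ} (hl : 0 < l) (hc : 0 < c)
    (u w : PosReal) :
    ¬ ((gig l 0 c).map fun x => (dKdVMap 0 β (x, u)).2).MutuallySingular
      ((gig l 0 c).map fun x => (dKdVMap 0 β (x, w)).2) := by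
  rintro ⟨s, hs, h1, h2⟩
  have key {s : Set PosReal} (hs : MeasurableSet s) {u : PosReal}
      (h : ((gig l 0 c).map fun x => (dKdVMap 0 β (x, u)).2) s = 0) :
      ∀ᵐ a : ℝ, (β * u : ℝ) < a → ∀ z ∈ s, (z : ℝ)⁻¹ ≠ a := by
    have hF : Measurable fun x => (dKdVMap 0 β (x, u)).2 :=
      (measurable_dKdVMap 0 β).snd.comp (measurable_id.prodMk measurable_const)
    rw [Measure.map_apply hF hs] at h
    refine ae_of_ae_exp_neg_add (P := fun a => ∀ z ∈ s, (z : ℝ)⁻¹ ≠ a) ?_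
    filter_upwards [ae_expPos_of_ae_gig le_rfl hc (fun _ => hl) (measure_eq_zero_iff_ae_notMem.1 h)]
      with ξ hξ z hz hza
    have h3 := (dKdVMap_zero_relations β (expPos ξ, u)).2.1
    have h4 : (((expPos ξ, u).1 : PosReal) : ℝ)⁻¹ = Real.exp (-ξ) := (Real.exp_neg ξ).symm
    rw [h4] at h3
    have : (dKdVMap 0 β (expPos ξ, u)).2 = z :=
      Subtype.ext (inv_injective (h3.trans hza.symm))
    exact hξ (by rw [Set.mem_preimage, this]; exact hz)
  have hpos : volume (Set.Ioi (max (β * u : ℝ) (β * w))) = 0 := by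
    rw [measure_eq_zero_iff_ae_notMem]
    filter_upwards [key hs h1, key hs.compl h2] with a ha1 ha2 ha
    have ha : max (β * u : ℝ) (β * w) < a := ha
    obtain ⟨hau, haw⟩ := max_lt_iff.1 ha
    have hu : (0 : ℝ) < u := u.2
    have ha0 : 0 < a := lt_of_le_of_lt (by positivity) hau
    by_cases hz : (⟨a⁻¹, Set.mem_Ioi.2 (inv_pos.2 ha0)⟩ : PosReal) ∈ s
    · exact ha1 hau _ hz (inv_inv a)
    · exact ha2 haw _ hz (inv_inv a)
  simp at hpos

lemma DetailedBalance.right_eq_gig {β : ℝ≥0} {ν : Measure PosReal} {l c : ℝ} (hl : 0 < l)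
    (hc : 0 < c) (h : DetailedBalance (dKdVMap 0 β) (gig l 0 c) ν) : ν = gig l (c * β) c := by
  have hg := detailedBalance_gig (α := 0) (β := β) (l := l) (c := c) (fun _ => hl) hc
  rw [NNReal.coe_zero, mul_zero] at hg
  have := h.isProbabilityMeasure_left
  have := h.isProbabilityMeasure_right
  have := hg.isProbabilityMeasure_right
  have (u : PosReal) : IsProbabilityMeasure ((gig l 0 c).map fun x => (dKdVMap 0 β (x, u)).2) :=
    Measure.isProbabilityMeasure_map ((measurable_dKdVMap 0 β).snd.comp
      (measurable_id.prodMk measurable_const)).aemeasurable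
  exact eq_of_invariant_of_not_mutuallySingular (measurable_map_dKdVMap_snd β _)
    (not_mutuallySingular_map_dKdVMap_snd β hl hc) h.bind_eq_right hg.bind_eq_right

/-- Invariance forces u(1 + βx₀u) = x₀ almost surely, and the left side is strictly increasing in u
> 0. -/
lemma DetailedBalance.right_eq_dirac {β : ℝ≥0} {x₀ : PosReal} {ν : Measure PosReal}
    (h : DetailedBalance (dKdVMap 0 β) (Measure.dirac x₀) ν) :
    ∃ u₀, ν = Measure.dirac u₀ := by
  have := h.isProbabilityMeasure_right
  have hx₀ : (0 : ℝ) < x₀ := x₀.2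
  have h1 : ∀ᵐ p ∂((Measure.dirac x₀).prod ν), p.1 = x₀ := by
    rw [Measure.dirac_prod]
    refine (ae_map_iff measurable_prodMk_left.aemeasurable
      (measurable_fst (measurableSet_singleton x₀))).2 (Filter.Eventually.of_forall fun u => rfl)
  rw [← h.map_eq, Measure.dirac_prod,
    Measure.map_map (measurable_dKdVMap 0 β) measurable_prodMk_left] at h1
  have h2 := ae_of_ae_map ((measurable_dKdVMap 0 β).comp measurable_prodMk_left).aemeasurable h1
  have h3 : ∀ᵐ u : PosReal ∂ν, (u : ℝ) * (1 + β * x₀ * u) = x₀ := by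
    filter_upwards [h2] with u hu
    have := congrArg Subtype.val hu
    simpa [dKdVMap] using this
  obtain ⟨u₀, hu₀⟩ := h3.exists
  refine ⟨u₀, eq_dirac_of_ae_eq ?_⟩
  filter_upwards [h3] with u hu
  have p1 : (0 : ℝ) < u := u.2
  have p2 : (0 : ℝ) < u₀ := u₀.2
  have hz : ((u : ℝ) - u₀) * (1 + β * x₀ * (u + u₀)) = 0 := by linear_combination hu - hu₀
  have hne : 1 + (β : ℝ) * x₀ * (u + u₀) ≠ 0 := by positivity
  exact Subtype.ext (sub_eq_zero.1 ((mul_eq_zero.1 hz).resolve_right hne))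

/-! ### Classification when αβ = 0 -/

/-- The solutions of the detailed balance equation in the case `α = 0 < β`. -/
theorem DetailedBalance.eq_gig_of_zero_left {β : ℝ≥0} {μ ν : Measure PosReal}
    (h : DetailedBalance (dKdVMap 0 β) μ ν) (hβ : 0 < β)
    (hnd : ¬ ∃ p : PosReal × PosReal, μ.prod ν = Measure.dirac p) :
    ∃ l c : ℝ, 0 < l ∧ 0 < c ∧ μ = gig l 0 c ∧ ν = gig l (c * β) c := by
  rcases h.left_eq_dirac_or_eq_gig hβ with ⟨x₀, rfl⟩ | ⟨l, c, hl, hc, rfl⟩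
  · obtain ⟨u₀, rfl⟩ := h.right_eq_dirac
    exact absurd ⟨(x₀, u₀), Measure.dirac_prod_dirac⟩ hnd
  · exact ⟨l, c, hl, hc, rfl, h.right_eq_gig hl hc⟩

/-- Exchanging the coordinates conjugates the map to the one with α and β exchanged, which reduces β
= 0 to α = 0. -/
lemma DetailedBalance.swap {α β : ℝ≥0} {μ ν : Measure PosReal}
    (h : DetailedBalance (dKdVMap α β) μ ν) : DetailedBalance (dKdVMap β α) ν μ := by
  have := h.isProbabilityMeasure_left
  have := h.isProbabilityMeasure_right
  refine ⟨inferInstance, inferInstance, ?_⟩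
  have hcomm : dKdVMap β α ∘ Prod.swap = Prod.swap ∘ dKdVMap α β := by
    funext ⟨⟨x, hx⟩, ⟨u, hu⟩⟩
    refine Prod.ext (Subtype.ext ?_) (Subtype.ext ?_) <;>
      simp only [dKdVMap, Prod.swap, Function.comp, mul_assoc, mul_comm u x]
  rw [← Measure.prod_swap, Measure.map_map (measurable_dKdVMap β α) measurable_swap, hcomm,
    ← Measure.map_map measurable_swap (measurable_dKdVMap α β), h.map_eq]

lemma DetailedBalance.eq_of_dKdVMap_self {α : ℝ≥0} {μ ν : Measure PosReal}
    (h : DetailedBalance (dKdVMap α α) μ ν) : μ = ν := by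
  have := h.isProbabilityMeasure_left
  have := h.isProbabilityMeasure_right
  have hs := h.map_eq
  rw [dKdVMap_self, Measure.prod_swap] at hs
  have := congrArg Measure.snd hs
  simpa using this

theorem proposition3p9 (α β : ℝ≥0) :
    -- (a) products of generalized inverse Gaussian distributions
    (∀ l c : ℝ, (α * β = 0 → 0 < l) → 0 < c →
      DetailedBalance (dKdVMap α β) (gig l (c * α) c) (gig l (c * β) c)) ∧
    -- (b) any product `m × m`, if `α = β`
    (α = β → ∀ m : Measure PosReal, IsProbabilityMeasure m →
      DetailedBalance (dKdVMap α β) m m) ∧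
    -- if `α β = 0`, every solution that is not a Dirac measure is one of those in (a) and (b)
    (α * β = 0 → ∀ μ ν : Measure PosReal, DetailedBalance (dKdVMap α β) μ ν →
      (¬ ∃ p : PosReal × PosReal, μ.prod ν = Measure.dirac p) →
      (∃ l c : ℝ, 0 < l ∧ 0 < c ∧ μ = gig l (c * α) c ∧ ν = gig l (c * β) c) ∨
      (α = β ∧ μ = ν)) := by
  refine ⟨fun l c hl hc => detailedBalance_gig hl hc, ?_, ?_⟩
  · rintro rfl m hm
    exact detailedBalance_dKdVMap_self α m
  · intro hαβ μ ν h hnd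
    rcases eq_or_ne α β with rfl | hne
    · exact Or.inr ⟨rfl, h.eq_of_dKdVMap_self⟩
    left
    rcases mul_eq_zero.1 hαβ with rfl | rfl
    · simpa using h.eq_gig_of_zero_left (pos_iff_ne_zero.2 hne.symm) hnd
    · have := h.isProbabilityMeasure_left
      have := h.isProbabilityMeasure_right
      obtain ⟨l, c, hl, hc, hν, hμ⟩ := h.swap.eq_gig_of_zero_left (pos_iff_ne_zero.2 hne) (by
        rintro ⟨p, hp⟩
        refine hnd ⟨p.swap, ?_⟩
        rw [← Measure.prod_swap, hp, Measure.map_dirac' measurable_swap])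
      exact ⟨l, c, hl, hc, hμ, by simpa using hν⟩
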